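/- Let $n\ge 1$ and let $\mathcal L^n$ denote the Lebesgue outer measure on $\mathbb{R}^n$. For $E\subset\mathbb{R}^n$ and real $m\ge n$, let $E^{(m)}$ (the set of $m$-density points of $E$) be the set of all $x\in\mathbb{R}^n$ such that $$\lim_{r\to 0^+}\frac{\mathcal L^n(B(x,r)\setminus E)}{r^m}=0,$$ where $B(x,r)$ is the open Euclidean ball of radius $r$ centered at $x$. The density-degree function $d_E:\mathbb{R}^n\to[0,+\infty]$ of $E$ is defined by $d_E(x)=\sup\{m\in[n,+\infty)\mid x\in E^{(m)}\}$ if $x\in E^{(n)}$, and $d_E(x)=0$ if $x\notin E^{(n)}$. **Theorem 5.1.** Let $f:\mathbb{R}^n\to[-\infty,+\infty]$ be a (Lebesgue) measurable function such that $f(x)\in\{0\}\cup[n,+\infty]$ for almost every $x\in\mathbb{R}^n$. Then there exists a sequence $(F_k)_{k=1}^\infty$ of closed subsets of $\mathbb{R}^n$ such that $\lim_{k\to\infty}d_{F_k}(x)=f(x)$ in $[-\infty,+\infty]$ for almost every $x\in\mathbb{R}^n$. -/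

import Mathlib

open MeasureTheory Filter Topology
open scoped ENNReal

noncomputable section

/-- The set `E^(m)` of `m`-density points of an arbitrary subset `E` of `ℝⁿ`: the points `x` with
`ℒⁿ(B(x, r) \ E) / r ^ m → 0` as `r → 0⁺`. On sets that need not be measurable, `volume` is the
Lebesgue outer measure. -/
def densityPoints {n : ℕ} (m : ℝ) (E : Set (EuclideanSpace ℝ (Fin n))) :
    Set (EuclideanSpace ℝ (Fin n)) :=
  {x | Tendsto (fun r : ℝ => volume (Metric.ball x r \ E) / ENNReal.ofReal (r ^ m))
    (𝓝[>] 0) (𝓝 0)}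

open Classical in
/-- The density-degree function `d_E : ℝⁿ → [0, +∞]` of a subset `E` of `ℝⁿ`: the supremum of the
real numbers `m ≥ n` with `x ∈ E^(m)` if `x ∈ E^(n)`, and `0` otherwise. -/
def densityDegree {n : ℕ} (E : Set (EuclideanSpace ℝ (Fin n)))
    (x : EuclideanSpace ℝ (Fin n)) : ℝ≥0∞ :=
  if x ∈ densityPoints (n : ℝ) E then
    sSup (ENNReal.ofReal '' {m : ℝ | (n : ℝ) ≤ m ∧ x ∈ densityPoints m E})
  else 0

end

/-! For `m > n`, put `a i = 2^(-i)`, `s i = (a i)^i`, and remove from space balls of radius `(s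
i)^(m/n)` around an `s i`-net, for all large `i`. Every ball of radius `2 * s i` contains a hole of
volume comparable to `(s i)^m`, so no point has `m`-density. Off a set of small measure, `x` is `2 *
s i * a i` away from every net. The holes of scale `i` then occupy at most a constant times `(s
i)^(m-k) * (a i)^(-k) * r^k` of `B(x, r)`, and this is summable in `i` for `k < m`. So the degree is
exactly `m` there (`exists_isClosed_densityDegree_eq`).

Density-degree is local and vanishes off a closed set. Such sets can thus be pasted inside disjoint
neighbourhoods of compact pieces of the level sets of a simple function. Simple functions converging
to `f`, with summable errors on growing balls, conclude by Borel–Cantelli. -/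

theorem exists_separated_net {X : Type*} [PseudoMetricSpace X] {s : ℝ} (hs : 0 < s) :
    ∃ P : Set X, (P.Pairwise fun p q => s ≤ dist p q) ∧ ∀ x, ∃ p ∈ P, dist x p < s := by
  obtain ⟨P, hP⟩ := zorn_subset {P : Set X | P.Pairwise fun p q => s ≤ dist p q} (by
    intro c hc hchain
    exact ⟨⋃₀ c, (Set.pairwise_sUnion hchain.directedOn).2 fun t ht => hc ht,
      fun t ht => Set.subset_sUnion_of_mem ht⟩)
  refine ⟨P, hP.prop, fun x => ?_⟩
  by_contra! h
  have hx : x ∉ P := fun hx => by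
    have := h x hx
    rw [dist_self] at this
    linarith
  refine hx (hP.le_of_ge (y := insert x P) ?_ (Set.subset_insert x P) (Set.mem_insert x P))
  refine hP.prop.insert fun q hq _ => ⟨h q hq, ?_⟩
  rw [dist_comm]
  exact h q hq

/-- A union of balls of radius `ρ` around an `s`-separated set occupies in a ball of radius `r` at
most the fraction `(2 * ρ / s) ^ d` of the measure of a slightly larger ball. -/
theorem measure_ball_inter_biUnion_ball_le {E : Type*} [NormedAddCommGroup E] [NormedSpace ℝ E]
    [FiniteDimensional ℝ E] [MeasurableSpace E] [BorelSpace E] (μ : Measure E)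
    [μ.IsAddHaarMeasure] {P : Set E} {s ρ : ℝ} (hs : 0 < s) (hρ : 0 < ρ)
    (hP : P.Pairwise fun p q => s ≤ dist p q) (x : E) (r : ℝ) :
    μ (Metric.ball x r ∩ ⋃ p ∈ P, Metric.ball p ρ) ≤
      ENNReal.ofReal ((2 * ρ / s) ^ Module.finrank ℝ E) * μ (Metric.ball x (r + ρ + s / 2)) := by
  set Q : Set E := P ∩ Metric.ball x (r + ρ)
  have hdisj : Q.PairwiseDisjoint fun p => Metric.ball p (s / 2) := fun p hp q hq hpq =>
    Metric.ball_disjoint_ball (by linarith [hP hp.1 hq.1 hpq])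
  have hQ : Q.Countable := hdisj.countable_of_isOpen (fun _ _ => Metric.isOpen_ball)
    fun p _ => ⟨p, Metric.mem_ball_self (by positivity)⟩
  have hball (p : E) : μ (Metric.ball p ρ) =
      ENNReal.ofReal ((2 * ρ / s) ^ Module.finrank ℝ E) * μ (Metric.ball p (s / 2)) := by
    rw [Measure.addHaar_ball_of_pos μ p hρ, Measure.addHaar_ball_of_pos μ p (half_pos hs),
      ← mul_assoc, ← ENNReal.ofReal_mul (by positivity), ← mul_pow]
    congr 3
    field_simp
  calc μ (Metric.ball x r ∩ ⋃ p ∈ P, Metric.ball p ρ)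
      ≤ μ (⋃ p ∈ Q, Metric.ball p ρ) := by
        refine measure_mono ?_
        rintro y ⟨hy, hyP⟩
        simp only [Set.mem_iUnion, exists_prop] at hyP ⊢
        obtain ⟨p, hp, hyp⟩ := hyP
        refine ⟨p, ⟨hp, ?_⟩, hyp⟩
        rw [Metric.mem_ball] at *
        linarith [dist_triangle p y x, dist_comm p y]
    _ ≤ ∑' p : Q, μ (Metric.ball (p : E) ρ) := measure_biUnion_le μ hQ _
    _ = ENNReal.ofReal ((2 * ρ / s) ^ Module.finrank ℝ E) *
          μ (⋃ p ∈ Q, Metric.ball p (s / 2)) := by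
        rw [measure_biUnion hQ hdisj fun _ _ => measurableSet_ball, ← ENNReal.tsum_mul_left]
        simp_rw [hball]
    _ ≤ _ := by
        gcongr
        simp only [Set.iUnion_subset_iff]
        rintro p ⟨-, hp⟩
        refine Metric.ball_subset_ball' ?_
        rw [Metric.mem_ball] at hp
        linarith

/-! ### Criteria for density points; locality of the density-degree -/

theorem mem_densityPoints_of_le {n : ℕ} {E : Set (EuclideanSpace ℝ (Fin n))}
    {x : EuclideanSpace ℝ (Fin n)} {m k C : ℝ} (hmk : m < k)
    (h : ∀ᶠ r in 𝓝[>] 0, volume (Metric.ball x r \ E) ≤ ENNReal.ofReal (C * r ^ k)) :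
    x ∈ densityPoints m E := by
  have hlim : Tendsto (fun r : ℝ => ENNReal.ofReal (C * r ^ (k - m))) (𝓝[>] 0) (𝓝 0) := by
    have h0 : Tendsto (fun r : ℝ => C * r ^ (k - m)) (𝓝[>] 0) (𝓝 (C * 0 ^ (k - m))) :=
      ((Real.continuousAt_rpow_const 0 (k - m) (Or.inr (by linarith))).tendsto.mono_left
        nhdsWithin_le_nhds).const_mul C
    rw [Real.zero_rpow (by linarith), mul_zero] at h0
    simpa using ENNReal.tendsto_ofReal h0
  refine tendsto_of_tendsto_of_tendsto_of_le_of_le' tendsto_const_nhds hlim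
    (Eventually.of_forall fun _ => zero_le) ?_
  filter_upwards [h, self_mem_nhdsWithin] with r hr (hr0 : 0 < r)
  have hpos : 0 < r ^ m := Real.rpow_pos_of_pos hr0 m
  rw [ENNReal.div_le_iff (by simpa using hpos) ENNReal.ofReal_ne_top,
    ← ENNReal.ofReal_mul' hpos.le, mul_assoc, ← Real.rpow_add hr0, sub_add_cancel]
  exact hr

theorem notMem_densityPoints_of_frequently_le {n : ℕ} {E : Set (EuclideanSpace ℝ (Fin n))}
    {x : EuclideanSpace ℝ (Fin n)} {m : ℝ} {c : ℝ≥0∞} (hc : c ≠ 0)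
    (h : ∃ᶠ r in 𝓝[>] 0, c * ENNReal.ofReal (r ^ m) ≤ volume (Metric.ball x r \ E)) :
    x ∉ densityPoints m E := by
  intro hx
  have hlt := (show Tendsto _ _ _ from hx).eventually_lt_const (pos_iff_ne_zero.2 hc)
  obtain ⟨r, hr, hr', hr0 : 0 < r⟩ := (h.and_eventually (hlt.and self_mem_nhdsWithin)).exists
  have hpos : 0 < r ^ m := Real.rpow_pos_of_pos hr0 m
  rw [ENNReal.div_lt_iff (Or.inl (by simpa using hpos)) (Or.inl ENNReal.ofReal_ne_top)] at hr'
  exact absurd hr hr'.not_ge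

theorem densityDegree_eq_ofReal {n : ℕ} {E : Set (EuclideanSpace ℝ (Fin n))}
    {x : EuclideanSpace ℝ (Fin n)} {m : ℝ} (hm : (n : ℝ) < m)
    (hlt : ∀ k, (n : ℝ) ≤ k → k < m → x ∈ densityPoints k E)
    (hge : ∀ k, m ≤ k → x ∉ densityPoints k E) :
    densityDegree E x = ENNReal.ofReal m := by
  have hset : {k : ℝ | (n : ℝ) ≤ k ∧ x ∈ densityPoints k E} = Set.Ico (n : ℝ) m := by
    ext k
    exact ⟨fun h => ⟨h.1, not_le.1 fun hk => hge k hk h.2⟩, fun h => ⟨h.1, hlt k h.1 h.2⟩⟩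
  rw [densityDegree, if_pos (hlt n le_rfl hm), hset]
  refine le_antisymm (sSup_le ?_) (le_of_forall_lt fun c hc => ?_)
  · rintro _ ⟨k, hk, rfl⟩
    exact ENNReal.ofReal_le_ofReal hk.2.le
  · have hctop : c ≠ ∞ := (hc.trans ENNReal.ofReal_lt_top).ne
    have hcm : c.toReal < m := by
      rwa [← ENNReal.ofReal_toReal hctop,
        ENNReal.ofReal_lt_ofReal_iff (lt_of_le_of_lt (Nat.cast_nonneg n) hm)] at hc
    obtain ⟨k, hk, hkm⟩ := exists_between (max_lt hm hcm)
    refine lt_sSup_iff.2 ⟨_, ⟨k, ⟨(le_max_left _ _).trans hk.le, hkm⟩, rfl⟩, ?_⟩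
    rw [ENNReal.lt_ofReal_iff_toReal_lt hctop]
    exact (le_max_right _ _).trans_lt hk

theorem densityPoints_congr {n : ℕ} {E F : Set (EuclideanSpace ℝ (Fin n))}
    {x : EuclideanSpace ℝ (Fin n)} (h : E =ᶠ[𝓝 x] F) (m : ℝ) :
    x ∈ densityPoints m E ↔ x ∈ densityPoints m F := by
  obtain ⟨δ, hδ, hball⟩ := Metric.eventually_nhds_iff_ball.1 h
  refine tendsto_congr' ?_
  filter_upwards [Ioo_mem_nhdsGT hδ] with r hr
  congr 2
  ext y
  refine and_congr_right fun hy => not_congr ?_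
  exact iff_of_eq (hball y (Metric.ball_subset_ball hr.2.le hy))

theorem densityDegree_congr {n : ℕ} {E F : Set (EuclideanSpace ℝ (Fin n))}
    {x : EuclideanSpace ℝ (Fin n)} (h : E =ᶠ[𝓝 x] F) :
    densityDegree E x = densityDegree F x := by
  by_cases hx : x ∈ densityPoints (n : ℝ) E
  · rw [densityDegree, densityDegree, if_pos hx, if_pos ((densityPoints_congr h n).1 hx)]
    simp only [densityPoints_congr h]
  · rw [densityDegree, densityDegree, if_neg hx, if_neg (mt (densityPoints_congr h n).2 hx)]

theorem IsClosed.densityDegree_eq_zero {n : ℕ} {F : Set (EuclideanSpace ℝ (Fin n))}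
    (hF : IsClosed F) {x : EuclideanSpace ℝ (Fin n)} (hx : x ∉ F) : densityDegree F x = 0 := by
  refine if_neg (notMem_densityPoints_of_frequently_le
    (c := volume (Metric.ball (0 : EuclideanSpace ℝ (Fin n)) 1))
    (Metric.measure_ball_pos volume _ one_pos).ne' (Eventually.frequently ?_))
  obtain ⟨δ, hδ, hball⟩ := Metric.isOpen_iff.1 hF.isOpen_compl x hx
  filter_upwards [Ioo_mem_nhdsGT hδ] with r hr
  have hdiff : Metric.ball x r \ F = Metric.ball x r :=
    (Set.disjoint_left.2 fun y hy => hball (Metric.ball_subset_ball hr.2.le hy)).sdiff_eq_left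
  rw [hdiff, Measure.addHaar_ball_of_pos volume x hr.1, finrank_euclideanSpace_fin,
    Real.rpow_natCast, mul_comm]

/-! ### Closed sets of constant density-degree -/

/-- If `x` stays at distance `2 * s * a` from an `s`-separated set `P`, then the union of the balls
of radius `ρ` around `P` is superdense-negligible at `x`, uniformly in the radius `r`. -/
theorem volume_ball_inter_biUnion_ball_le_rpow {n : ℕ} {P : Set (EuclideanSpace ℝ (Fin n))}
    {s a ρ m k r : ℝ} {x : EuclideanSpace ℝ (Fin n)} (hs : 0 < s) (ha : 0 < a) (ha1 : a ≤ 1)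
    (hρ : 0 < ρ) (hρa : ρ ≤ s * a) (hρm : ρ ^ n ≤ s ^ m) (hk : (n : ℝ) ≤ k) (hr : 0 < r)
    (hP : P.Pairwise fun p q => s ≤ dist p q) (hx : ∀ p ∈ P, 2 * (s * a) ≤ dist x p) :
    volume (Metric.ball x r ∩ ⋃ p ∈ P, Metric.ball p ρ) ≤
      ENNReal.ofReal (s ^ (m - k) * a ^ (-k)) * ENNReal.ofReal (6 ^ n * r ^ k) *
        volume (Metric.ball (0 : EuclideanSpace ℝ (Fin n)) 1) := by
  -- In the small case `r + ρ ≤ 2 * (s * a)`, so `B(x, r)` meets no hole.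
  rcases le_or_gt r (s * a) with hra | hra
  · have hempty : Metric.ball x r ∩ ⋃ p ∈ P, Metric.ball p ρ = ∅ := by
      rw [← Set.disjoint_iff_inter_eq_empty, Set.disjoint_iUnion₂_right]
      exact fun p hp => Metric.ball_disjoint_ball (by linarith [hx p hp])
    simp [hempty]
  have hsa : s < r / a := by rwa [lt_div_iff₀ ha]
  have hu : 0 < r / a := by positivity
  have hru : r ≤ r / a := le_div_self hr.le ha ha1
  have hρs : ρ ≤ s := hρa.trans (mul_le_of_le_one_right hs.le ha1)
  refine (measure_ball_inter_biUnion_ball_le volume hs hρ hP x r).trans ?_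
  rw [Measure.addHaar_ball_of_pos volume x (by positivity), ← mul_assoc,
    finrank_euclideanSpace_fin, ← ENNReal.ofReal_mul (by positivity),
    ← ENNReal.ofReal_mul (by positivity)]
  gcongr ENNReal.ofReal ?_ * _
  have h1 : (r + ρ + s / 2) ^ n ≤ (3 * (r / a)) ^ n := by
    gcongr
    linarith
  -- The surplus factor `s ^ (k - n)` is traded for a power of `r / a > s`.
  have h2 : s ^ (m - n) * (r / a) ^ (n : ℝ) ≤ s ^ (m - k) * (r / a) ^ k := by
    have e1 : s ^ (m - n) = s ^ (m - k) * s ^ (k - n) := by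
      rw [← Real.rpow_add hs]; ring_nf
    have e2 : (r / a) ^ k = (r / a) ^ (k - n) * (r / a) ^ (n : ℝ) := by
      rw [← Real.rpow_add hu]; ring_nf
    rw [e1, e2, mul_assoc]
    have : s ^ (k - n) ≤ (r / a) ^ (k - n) :=
      Real.rpow_le_rpow hs.le hsa.le (by linarith)
    gcongr
  calc (2 * ρ / s) ^ n * (r + ρ + s / 2) ^ n
      ≤ (2 * ρ / s) ^ n * (3 * (r / a)) ^ n := by gcongr
    _ = 6 ^ n * (ρ ^ n / s ^ n * (r / a) ^ n) := by
        rw [← div_pow, ← mul_pow, ← mul_pow, ← mul_pow]; ring_nf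
    _ ≤ 6 ^ n * (s ^ m / s ^ n * (r / a) ^ n) := by gcongr
    _ = 6 ^ n * (s ^ (m - n) * (r / a) ^ (n : ℝ)) := by
        rw [Real.rpow_sub hs, Real.rpow_natCast, Real.rpow_natCast]
    _ ≤ 6 ^ n * (s ^ (m - k) * (r / a) ^ k) := by gcongr
    _ = s ^ (m - k) * a ^ (-k) * (6 ^ n * r ^ k) := by
        rw [Real.div_rpow hr.le ha.le, Real.rpow_neg ha.le]; ring

theorem eventually_one_le_natCast_mul_sub {c : ℝ} (hc : 0 < c) (b : ℝ) :
    ∀ᶠ i : ℕ in atTop, 1 ≤ i * c - b := by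
  filter_upwards [(tendsto_natCast_atTop_atTop.atTop_mul_const hc).eventually_ge_atTop (1 + b)]
    with i hi
  linarith

theorem half_pow_pow_rpow (i : ℕ) (c : ℝ) :
    (((1 / 2 : ℝ) ^ i) ^ i) ^ c = ((1 / 2 : ℝ) ^ i) ^ (i * c) := by
  rw [← Real.rpow_natCast (((1 / 2 : ℝ) ^ i)) i, ← Real.rpow_mul (by positivity)]

theorem half_pow_rpow_le {i : ℕ} {c : ℝ} (hc : 1 ≤ c) :
    ((1 / 2 : ℝ) ^ i) ^ c ≤ (1 / 2 : ℝ) ^ i := by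
  have := Real.rpow_le_rpow_of_exponent_ge (x := (1 / 2 : ℝ) ^ i) (by positivity)
    (pow_le_one₀ (by norm_num) (by norm_num)) hc
  rwa [Real.rpow_one] at this

/-- The exponent of `2^(-i)` is `i * (m - k) - k`, eventually at least `1`; this is why the scales
decay like `2^(-i^2)`. -/
theorem summable_half_pow_pow_rpow_mul {m k : ℝ} (hkm : k < m) :
    Summable fun i : ℕ => (((1 / 2 : ℝ) ^ i) ^ i) ^ (m - k) * ((1 / 2 : ℝ) ^ i) ^ (-k) := by
  refine Summable.of_norm_bounded_eventually_nat
    (summable_geometric_of_lt_one (r := (1 / 2 : ℝ)) (by norm_num) (by norm_num)) ?_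
  filter_upwards [eventually_one_le_natCast_mul_sub (sub_pos.2 hkm) k] with i hi
  rw [Real.norm_of_nonneg (by positivity), half_pow_pow_rpow, ← Real.rpow_add (by positivity)]
  exact half_pow_rpow_le (by linarith)

theorem eventually_half_pow_pow_rpow_le {c : ℝ} (hc : 1 < c) :
    ∀ᶠ i : ℕ in atTop, (((1 / 2 : ℝ) ^ i) ^ i) ^ c ≤ ((1 / 2 : ℝ) ^ i) ^ i * (1 / 2 : ℝ) ^ i := by
  filter_upwards [eventually_one_le_natCast_mul_sub (sub_pos.2 hc) 0] with i hi
  have hsplit : i * c = i * (c - 1) - 0 + i := by ring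
  rw [half_pow_pow_rpow, hsplit, Real.rpow_add (by positivity), Real.rpow_natCast, mul_comm]
  gcongr
  exact half_pow_rpow_le hi

/-- For every `m > n` there is a closed set whose density-degree is `m` on a bounded region up to
a set of small measure. -/
theorem exists_isClosed_densityDegree_eq {n : ℕ} (hn : 1 ≤ n) {m : ℝ} (hm : (n : ℝ) < m) (R : ℝ)
    {ε : ℝ≥0∞} (hε : ε ≠ 0) :
    ∃ G : Set (EuclideanSpace ℝ (Fin n)), IsClosed G ∧
      volume {x ∈ Metric.ball 0 R | densityDegree G x ≠ ENNReal.ofReal m} ≤ ε := by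
  have hn0 : (0 : ℝ) < n := by exact_mod_cast hn
  set ω := volume (Metric.ball (0 : EuclideanSpace ℝ (Fin n)) 1) with hω
  have hωtop : ω ≠ ∞ := measure_ball_lt_top.ne
  set a : ℕ → ℝ := fun i => (1 / 2) ^ i with ha
  set s : ℕ → ℝ := fun i => a i ^ i with hs
  set ρ : ℕ → ℝ := fun i => s i ^ (m / n) with hρ
  have ha0 (i) : 0 < a i := by positivity
  have ha1 (i) : a i ≤ 1 := pow_le_one₀ (by norm_num) (by norm_num)
  have hs0 (i) : 0 < s i := by positivity
  have hs1 (i) : s i ≤ 1 := pow_le_one₀ (ha0 i).le (ha1 i)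
  have hsa (i : ℕ) (hi : i ≠ 0) : s i ≤ a i := pow_le_of_le_one (ha0 i).le (ha1 i) hi
  have hρ0 (i) : 0 < ρ i := Real.rpow_pos_of_pos (hs0 i) _
  have hρm (i) : ρ i ^ n = s i ^ m := by
    rw [hρ, ← Real.rpow_natCast, ← Real.rpow_mul (hs0 i).le, div_mul_cancel₀ _ hn0.ne']
  choose P hPsep hPnet using fun i =>
    exists_separated_net (X := EuclideanSpace ℝ (Fin n)) (hs0 i)
  set B : ℕ → Set (EuclideanSpace ℝ (Fin n)) :=
    fun i => Metric.ball 0 R ∩ ⋃ p ∈ P i, Metric.ball p (2 * (s i * a i)) with hB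
  have hBle (i) : volume (B i) ≤ ENNReal.ofReal (4 ^ n * a i) *
      volume (Metric.ball (0 : EuclideanSpace ℝ (Fin n)) (R + 3)) := by
    refine (measure_ball_inter_biUnion_ball_le volume (hs0 i)
      (mul_pos two_pos (mul_pos (hs0 i) (ha0 i))) (hPsep i) 0 R).trans ?_
    have hsai : s i * a i ≤ 1 := mul_le_one₀ (hs1 i) (ha0 i).le (ha1 i)
    have heq : 2 * (2 * (s i * a i)) / s i = 4 * a i := by
      have := (hs0 i).ne'
      field_simp
      ring
    rw [finrank_euclideanSpace_fin, heq, mul_pow]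
    gcongr ENNReal.ofReal (_ * ?_) * volume (Metric.ball _ ?_)
    · exact pow_le_of_le_one (ha0 i).le (ha1 i) (by omega)
    · linarith [hs1 i]
  have hBsum : ∑' i, volume (B i) ≠ ∞ := by
    refine ne_top_of_le_ne_top ?_ (ENNReal.tsum_le_tsum hBle)
    rw [ENNReal.tsum_mul_right]
    refine ENNReal.mul_ne_top ?_ measure_ball_lt_top.ne
    exact ((summable_geometric_of_lt_one (by norm_num) (by norm_num)).mul_left _).tsum_ofReal_ne_top
  have hρev : ∀ᶠ j in atTop, ∀ i ≥ j, ρ i ≤ s i * a i :=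
    eventually_forall_ge_atTop.2
      (eventually_half_pow_pow_rpow_le ((one_lt_div hn0).2 hm))
  -- Discarding the first `j` scales makes the exceptional set small and the holes much smaller than
  -- the spacing.
  obtain ⟨j, hρj, hj⟩ := (hρev.and ((ENNReal.tendsto_sum_nat_add _ hBsum).eventually_le_const
    (pos_iff_ne_zero.2 hε))).exists
  set U : Set (EuclideanSpace ℝ (Fin n)) :=
    ⋃ i, ⋃ p ∈ P (i + j), Metric.ball p (ρ (i + j)) with hU
  have hUopen : IsOpen U := isOpen_iUnion fun i => isOpen_biUnion fun p _ => Metric.isOpen_ball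
  refine ⟨Uᶜ, hUopen.isClosed_compl, (measure_mono ?_).trans ((measure_iUnion_le _).trans hj)⟩
  rintro x ⟨hxR, hx⟩
  by_contra hxB
  have hfar (i) (p) (hp : p ∈ P (i + j)) : 2 * (s (i + j) * a (i + j)) ≤ dist x p := by
    by_contra! hlt
    exact hxB (Set.mem_iUnion.2 ⟨i, hxR, Set.mem_biUnion hp hlt⟩)
  refine hx (densityDegree_eq_ofReal hm (fun k hk hkm => ?_) fun k hk => ?_)
  -- A bound of order `r ^ l` with `l > k` is needed for the quotient by `r ^ k` to vanish in the
  -- limit.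
  · obtain ⟨l, hkl, hlm⟩ := exists_between hkm
    set c : ℕ → ℝ := fun i => s (i + j) ^ (m - l) * a (i + j) ^ (-l) with hc
    have hcsum : Summable c := (summable_nat_add_iff j).2 (summable_half_pow_pow_rpow_mul hlm)
    have hc0 (i) : 0 ≤ c i := by have := hs0 (i + j); have := ha0 (i + j); positivity
    refine mem_densityPoints_of_le (C := (∑' i, c i) * 6 ^ n * ω.toReal) hkl ?_
    filter_upwards [self_mem_nhdsWithin] with r (hr : 0 < r)
    have hdiff : Metric.ball x r \ Uᶜ =
        ⋃ i, Metric.ball x r ∩ ⋃ p ∈ P (i + j), Metric.ball p (ρ (i + j)) :=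
      sdiff_compl.trans (Set.inter_iUnion _ _)
    rw [hdiff]
    refine (measure_iUnion_le _).trans ((ENNReal.tsum_le_tsum fun i =>
      volume_ball_inter_biUnion_ball_le_rpow (hs0 _) (ha0 _) (ha1 _) (hρ0 _)
        (hρj _ (Nat.le_add_left _ _)) (hρm _).le (hk.trans hkl.le) hr (hPsep _) (hfar i)).trans ?_)
    rw [ENNReal.tsum_mul_right, ENNReal.tsum_mul_right, ← ENNReal.ofReal_tsum_of_nonneg hc0 hcsum,
      ← hω, ← ENNReal.ofReal_toReal hωtop, ← ENNReal.ofReal_mul (tsum_nonneg hc0),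
      ← ENNReal.ofReal_mul (mul_nonneg (tsum_nonneg hc0) (by positivity)),
      ENNReal.toReal_ofReal ENNReal.toReal_nonneg]
    exact le_of_eq (by ring_nf)
  · refine notMem_densityPoints_of_frequently_le
      (c := ENNReal.ofReal ((1 / 2) ^ k) * ω) (mul_ne_zero
        (by simpa using Real.rpow_pos_of_pos (by norm_num) k)
        (Metric.measure_ball_pos volume _ one_pos).ne') ?_
    have hs_tendsto : Tendsto s atTop (𝓝 0) := by
      refine squeeze_zero' (Eventually.of_forall fun i => (hs0 i).le) ?_
        (tendsto_pow_atTop_nhds_zero_of_lt_one (r := (1 / 2 : ℝ)) (by norm_num) (by norm_num))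
      filter_upwards [eventually_ne_atTop 0] with i hi using hsa i hi
    -- A net point lies within `s` of `x` and its hole has radius at most `s`, so radius `2 * s`
    -- captures the hole.
    have hr_tendsto : Tendsto (fun i => 2 * s (i + j)) atTop (𝓝[>] 0) := by
      refine tendsto_nhdsWithin_iff.2 ⟨?_, Eventually.of_forall fun i => ?_⟩
      · simpa using (hs_tendsto.comp (tendsto_add_atTop_nat j)).const_mul 2
      · have := hs0 (i + j)
        exact mul_pos two_pos this
    refine hr_tendsto.frequently (Frequently.of_forall fun i => ?_)
    obtain ⟨p, hp, hxp⟩ := hPnet (i + j) x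
    have hρs : ρ (i + j) ≤ s (i + j) := (hρj _ (Nat.le_add_left _ _)).trans
      (mul_le_of_le_one_right (hs0 _).le (ha1 _))
    have hsub : Metric.ball p (ρ (i + j)) ⊆ Metric.ball x (2 * s (i + j)) \ Uᶜ := by
      refine fun y hy => ⟨?_, fun hyU => hyU (Set.mem_iUnion.2 ⟨i, Set.mem_biUnion hp hy⟩)⟩
      rw [Metric.mem_ball] at hy ⊢
      linarith [dist_triangle y p x, dist_comm x p]
    have hhalf : 1 / 2 * (2 * s (i + j)) = s (i + j) := by ring
    refine le_trans ?_ (measure_mono hsub)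
    rw [Measure.addHaar_ball_of_pos volume p (hρ0 _), finrank_euclideanSpace_fin, hρm,
      mul_right_comm, ← ENNReal.ofReal_mul (Real.rpow_nonneg (by norm_num) _),
      ← Real.mul_rpow (by norm_num) (by have := hs0 (i + j); positivity),
      hhalf]
    gcongr ENNReal.ofReal ?_ * _
    exact Real.rpow_le_rpow_of_exponent_ge (hs0 _) (hs1 _) hk

/-! ### Pasting along the level sets of a simple function -/

theorem eventually_pairwise_disjoint_cthickening {X ι : Type*} [PseudoMetricSpace X] (S : Finset ι)
    {K : ι → Set X} (hK : ∀ i, IsCompact (K i)) (hKc : ∀ i, IsClosed (K i))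
    (hdisj : (S : Set ι).PairwiseDisjoint K) :
    ∀ᶠ δ in 𝓝[>] (0 : ℝ),
      (S : Set ι).PairwiseDisjoint fun i => Metric.cthickening δ (K i) := by
  have h : ∀ i ∈ S, ∀ j ∈ S, ∀ᶠ δ in 𝓝[>] (0 : ℝ),
      i ≠ j → Disjoint (Metric.cthickening δ (K i)) (Metric.cthickening δ (K j)) := by
    intro i hi j hj
    by_cases hij : i = j
    · exact Eventually.of_forall fun _ h => absurd hij h
    obtain ⟨δ₀, hδ₀, hd⟩ := (hdisj hi hj hij).exists_cthickenings (hK i) (hKc j)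
    filter_upwards [Ioo_mem_nhdsGT hδ₀] with δ hδ _
    exact hd.mono (Metric.cthickening_mono hδ.2.le _) (Metric.cthickening_mono hδ.2.le _)
  have h' := (S.eventually_all).2 fun i hi => (S.eventually_all).2 (h i hi)
  filter_upwards [h'] with δ hδ i hi j hj hij using hδ i hi j hj hij

theorem IsCompact.eventually_measure_cthickening_diff_le {X : Type*} [MetricSpace X] [ProperSpace X]
    [MeasurableSpace X] [OpensMeasurableSpace X] (μ : Measure X) [IsFiniteMeasureOnCompacts μ]
    {K : Set X} (hK : IsCompact K) {ε : ℝ≥0∞} (hε : ε ≠ 0) :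
    ∀ᶠ δ in 𝓝[>] (0 : ℝ), μ (Metric.cthickening δ K \ K) ≤ ε := by
  have hlim := (tendsto_measure_cthickening_of_isCompact (μ := μ) hK).mono_left
    (nhdsWithin_le_nhds (s := Set.Ioi 0))
  filter_upwards [hlim.eventually_le_const (ENNReal.lt_add_right hK.measure_lt_top.ne hε)]
    with δ hδ
  rw [measure_sdiff (Metric.self_subset_cthickening K) hK.measurableSet.nullMeasurableSet
    hK.measure_lt_top.ne]
  exact tsub_le_iff_left.2 hδ

/-- A simple function with values in `{0} ∪ (n, ∞)` agrees with the density-degree function of a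
closed set on a bounded region up to a set of small measure. -/
theorem MeasureTheory.SimpleFunc.exists_isClosed_densityDegree_eq {n : ℕ} (hn : 1 ≤ n)
    (g : SimpleFunc (EuclideanSpace ℝ (Fin n)) ℝ≥0∞)
    (hg : ∀ x, g x = 0 ∨ ((n : ℝ≥0∞) < g x ∧ g x ≠ ∞)) (R : ℝ) {ε : ℝ≥0∞} (hε : ε ≠ 0) :
    ∃ F : Set (EuclideanSpace ℝ (Fin n)), IsClosed F ∧
      volume {x ∈ Metric.ball 0 R | densityDegree F x ≠ g x} ≤ ε := by
  classical
  set S := g.range.erase 0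
  have hS (v) (hv : v ∈ S) : (n : ℝ≥0∞) < v ∧ v ≠ ∞ := by
    obtain ⟨hv0, hv⟩ := Finset.mem_erase.1 hv
    obtain ⟨x, rfl⟩ := SimpleFunc.mem_range.1 hv
    exact (hg x).resolve_left hv0
  -- Each nonzero value costs three errors: the bad set of `G v`, the loss `A v \ K v`, and the
  -- collar `V v \ K v`.
  set η : ℝ≥0∞ := ε / (S.card * 3 : ℕ)
  have hη : η ≠ 0 := (ENNReal.div_pos hε (ENNReal.natCast_ne_top _)).ne'
  have hG (v : ℝ≥0∞) : ∃ G : Set (EuclideanSpace ℝ (Fin n)), IsClosed G ∧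
      (v ∈ S → volume {x ∈ Metric.ball 0 R | densityDegree G x ≠ v} ≤ η) := by
    by_cases hv : v ∈ S
    · obtain ⟨hnv, hvtop⟩ := hS v hv
      obtain ⟨G, hG, hGη⟩ := _root_.exists_isClosed_densityDegree_eq hn (m := v.toReal)
        (by rwa [← ENNReal.toReal_natCast, ENNReal.toReal_lt_toReal (ENNReal.natCast_ne_top n)
          hvtop]) R hη
      rw [ENNReal.ofReal_toReal hvtop] at hGη
      exact ⟨G, hG, fun _ => hGη⟩
    · exact ⟨∅, isClosed_empty, fun h => absurd h hv⟩
  choose G hGc hGη using hG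
  set A : ℝ≥0∞ → Set (EuclideanSpace ℝ (Fin n)) := fun v => Metric.ball 0 R ∩ g ⁻¹' {v}
  have hAm (v) : MeasurableSet (A v) := measurableSet_ball.inter (g.measurableSet_fiber v)
  choose K hKA hK hKη using fun v => (hAm v).exists_isCompact_sdiff_lt (μ := volume)
    (measure_ne_top_of_subset Set.inter_subset_left measure_ball_lt_top.ne) hη
  have hKdisj : (S : Set ℝ≥0∞).PairwiseDisjoint K := fun v _ w _ hvw =>
    Set.disjoint_left.2 fun x hxv hxw => hvw ((hKA v hxv).2.symm.trans (hKA w hxw).2)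
  obtain ⟨δ, ⟨hδdisj, hδη⟩, hδ : 0 < δ⟩ :=
    (((eventually_pairwise_disjoint_cthickening S hK (fun v => (hK v).isClosed) hKdisj).and
      ((S.eventually_all).2 fun v _ =>
        (hK v).eventually_measure_cthickening_diff_le volume hη)).and self_mem_nhdsWithin).exists
  set V : ℝ≥0∞ → Set (EuclideanSpace ℝ (Fin n)) := fun v => Metric.cthickening δ (K v)
  set F : Set (EuclideanSpace ℝ (Fin n)) := ⋃ v ∈ S, V v ∩ G v
  have hFc : IsClosed F :=
    S.finite_toSet.isClosed_biUnion fun v _ => Metric.isClosed_cthickening.inter (hGc v)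
  have hFK (v) (hv : v ∈ S) (x) (hx : x ∈ K v) : densityDegree F x = densityDegree (G v) x := by
    refine densityDegree_congr ?_
    filter_upwards [Metric.isOpen_thickening.mem_nhds (Metric.self_subset_thickening hδ _ hx)]
      with y hy
    have hyV : y ∈ V v := Metric.thickening_subset_cthickening _ _ hy
    refine propext ⟨fun hyF => ?_, fun hyG => Set.mem_biUnion hv ⟨hyV, hyG⟩⟩
    obtain ⟨w, hw, hyw, hyG⟩ := Set.mem_iUnion₂.1 hyF
    by_cases hvw : w = v
    · exact hvw ▸ hyG
    · exact absurd hyV (Set.disjoint_left.1 (hδdisj hw hv hvw) hyw)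
  refine ⟨F, hFc, ?_⟩
  have hsub : {x ∈ Metric.ball 0 R | densityDegree F x ≠ g x} ⊆
      ⋃ v ∈ S, ({x ∈ Metric.ball 0 R | densityDegree (G v) x ≠ v} ∪ A v \ K v) ∪ V v \ K v := by
    rintro x ⟨hxR, hx⟩
    by_contra hxU
    simp only [Set.mem_iUnion, not_exists, Set.mem_union, not_or] at hxU
    by_cases hgx : g x = 0
    · refine hx (hgx ▸ hFc.densityDegree_eq_zero fun hxF => ?_)
      obtain ⟨v, hv, hxV, -⟩ := Set.mem_iUnion₂.1 hxF
      refine (hxU v hv).2 ⟨hxV, fun hxK => ?_⟩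
      exact (Finset.mem_erase.1 hv).1 ((hKA v hxK).2.symm.trans hgx)
    · have hv : g x ∈ S := Finset.mem_erase.2 ⟨hgx, g.mem_range_self x⟩
      obtain ⟨⟨hx1, hx2⟩, -⟩ := hxU _ hv
      have hxK : x ∈ K (g x) := by
        by_contra hxK
        exact hx2 ⟨⟨hxR, rfl⟩, hxK⟩
      exact hx1 ⟨hxR, hFK _ hv x hxK ▸ hx⟩
  calc volume {x ∈ Metric.ball 0 R | densityDegree F x ≠ g x}
      ≤ ∑ v ∈ S, (η + η + η) := by
        refine (measure_mono hsub).trans ((measure_biUnion_finset_le _ _).trans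
          (Finset.sum_le_sum fun v hv => ?_))
        refine (measure_union_le _ _).trans (add_le_add ((measure_union_le _ _).trans
          (add_le_add (hGη v hv) (hKη v).le)) (hδη v hv))
    _ = (S.card * 3 : ℕ) * η := by
        rw [Finset.sum_const, nsmul_eq_mul]
        push_cast
        ring
    _ ≤ ε := ENNReal.mul_div_le

/-! ### Approximation by simple functions and conclusion -/

theorem exists_simpleFunc_tendsto {α : Type*} [MeasurableSpace α] {φ : α → ℝ≥0∞}
    (hφ : Measurable φ) (n : ℕ) (hφn : ∀ x, φ x = 0 ∨ (n : ℝ≥0∞) ≤ φ x) :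
    ∃ g : ℕ → SimpleFunc α ℝ≥0∞,
      (∀ k x, g k x = 0 ∨ ((n : ℝ≥0∞) < g k x ∧ g k x ≠ ∞)) ∧
      ∀ x, Tendsto (fun k => g k x) atTop (𝓝 (φ x)) := by
  have hset : MeasurableSet {x | φ x = 0} := hφ (measurableSet_singleton 0)
  -- The added `1 / (k + 1)` pushes values strictly above `n`, as the construction requires; the
  -- value `∞` is reached only in the limit.
  refine ⟨fun k => SimpleFunc.piecewise _ hset 0
    ((SimpleFunc.eapprox φ k).map fun v : ℝ≥0∞ => max v (n : ℝ≥0∞) + ((k : ℝ≥0∞) + 1)⁻¹),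
    fun k x => ?_, fun x => ?_⟩
  · by_cases hx : φ x = 0
    · left
      simp [SimpleFunc.piecewise_apply, hx]
    · right
      have hmax : max (SimpleFunc.eapprox φ k x) (n : ℝ≥0∞) ≠ ∞ :=
        (max_lt (SimpleFunc.eapprox_lt_top φ k x) (ENNReal.natCast_lt_top n)).ne
      simp only [SimpleFunc.piecewise_apply, Set.mem_ofPred_eq, hx, if_false, SimpleFunc.map_apply]
      refine ⟨(le_max_right _ _).trans_lt (ENNReal.lt_add_right hmax (by simp)), ?_⟩
      exact ENNReal.add_ne_top.2 ⟨hmax, by simp⟩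
  · by_cases hx : φ x = 0
    · simp [SimpleFunc.piecewise_apply, hx]
    · simp only [SimpleFunc.piecewise_apply, Set.mem_ofPred_eq, hx, if_false, SimpleFunc.map_apply]
      have hinv : Tendsto (fun k : ℕ => ((k : ℝ≥0∞) + 1)⁻¹) atTop (𝓝 0) := by
        simpa [Function.comp_def] using
          ENNReal.tendsto_inv_nat_nhds_zero.comp (tendsto_add_atTop_nat 1)
      have := ((SimpleFunc.tendsto_eapprox hφ x).max
        (tendsto_const_nhds (x := (n : ℝ≥0∞)))).add hinv
      rwa [max_eq_left ((hφn x).resolve_left hx), add_zero] at this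

theorem theorem5p1 (n : ℕ) (hn : 1 ≤ n) (f : EuclideanSpace ℝ (Fin n) → EReal)
    (hf : NullMeasurable f (volume : Measure (EuclideanSpace ℝ (Fin n))))
    (hval : ∀ᵐ x ∂(volume : Measure (EuclideanSpace ℝ (Fin n))),
      f x ∈ ({0} ∪ Set.Icc (n : EReal) ⊤ : Set EReal)) :
    ∃ F : ℕ → Set (EuclideanSpace ℝ (Fin n)),
      (∀ k, IsClosed (F k)) ∧
      ∀ᵐ x ∂(volume : Measure (EuclideanSpace ℝ (Fin n))),
        Tendsto (fun k => ((densityDegree (F k) x : ℝ≥0∞) : EReal)) atTop (𝓝 (f x)) := by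
  obtain ⟨h, hh, hfh⟩ := hf.aemeasurable
  -- The constraint on values holds only almost everywhere; truncation enforces it everywhere.
  set φ : EuclideanSpace ℝ (Fin n) → ℝ≥0∞ := fun x =>
    if (n : ℝ≥0∞) ≤ (h x).toENNReal then (h x).toENNReal else 0
  have hhm : Measurable fun x => (h x).toENNReal := hh.ereal_toENNReal
  have hφ : Measurable φ :=
    hhm.ite (measurableSet_le measurable_const hhm) measurable_const
  have hφn (x) : φ x = 0 ∨ (n : ℝ≥0∞) ≤ φ x := by
    by_cases hx : (n : ℝ≥0∞) ≤ (h x).toENNReal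
    · right
      simpa only [φ, if_pos hx]
    · left
      simp only [φ, if_neg hx]
  have hfφ : ∀ᵐ x, f x = φ x := by
    filter_upwards [hval, hfh] with x hx hfx
    rw [hfx] at hx ⊢
    rcases hx with hx | hx
    · rw [Set.mem_singleton_iff] at hx
      simp [φ, hx]
    · have hle : (n : ℝ≥0∞) ≤ (h x).toENNReal := by
        have hcast : ((n : ℝ≥0∞) : EReal) = n := rfl
        rw [← EReal.toENNReal_coe (x := (n : ℝ≥0∞)), hcast]
        exact EReal.toENNReal_le_toENNReal hx.1
      have h0 : 0 ≤ h x := (by exact_mod_cast Nat.zero_le n : (0 : EReal) ≤ n).trans hx.1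
      simp only [φ, if_pos hle, EReal.coe_toENNReal h0]
  obtain ⟨g, hg, hgφ⟩ := exists_simpleFunc_tendsto hφ n hφn
  choose F hFc hF using fun k : ℕ => (g k).exists_isClosed_densityDegree_eq hn (hg k) k
    (ε := (1 / 2) ^ k) (pow_ne_zero _ (by simp))
  refine ⟨F, hFc, ?_⟩
  have hsum : ∑' k : ℕ, volume {x ∈ Metric.ball 0 (k : ℝ) | densityDegree (F k) x ≠ g k x} ≠ ∞ := by
    refine ne_top_of_le_ne_top ?_ (ENNReal.tsum_le_tsum hF)
    rw [ENNReal.tsum_geometric]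
    simp
  filter_upwards [hfφ, ae_eventually_notMem hsum] with x hfx hx
  rw [hfx]
  refine (continuous_coe_ennreal_ereal.tendsto _).comp ((hgφ x).congr' ?_)
  filter_upwards [hx, tendsto_natCast_atTop_atTop.eventually_gt_atTop (dist x 0)] with k hk hkx
  by_contra hne
  exact hk ⟨hkx, Ne.symm hne⟩
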